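/- Let $(\mathsf E,\mathscr E,\mu)$ be a probability space, let $L^2(\mu)$ be the real Hilbert space with inner product $\langle f,g\rangle=\int fg\,d\mu$ and norm $\|\cdot\|_2$, and let $L^2_0(\mu)=\{f\in L^2(\mu):\int f\,d\mu=0\}$. Let $T$ be a Markov kernel on $\mathsf E$ that leaves $\mu$ invariant (not necessarily reversible), regarded as the bounded operator $(Tf)(x)=\int f(y)\,T(x,dy)$ on $L^2(\mu)$. For $f\in L^2(\mu)$ put $\|f\|_{\mathrm{osc}}=\operatorname{ess\,sup}_\mu f-\operatorname{ess\,inf}_\mu f\in[0,\infty]$ and $\mathcal E(T,f)=\langle(\mathrm{Id}-T)f,f\rangle$. The kernel $T$ satisfies a $\|\cdot\|_{\mathrm{osc}}^2$-weak Poincaré inequality (WPI) * in the $\alpha$-form, if there is a non-increasing function $\alpha:(0,\infty)\to[0,\infty)$ such that $\|f\|_2^2\le\alpha(r)\,\mathcal E(T,f)+r\,\|f\|_{\mathrm{osc}}^2$ for all $r>0$ and $f\in L^2_0(\mu)$; * in the $\beta$-form, if there is a non-increasing function $\beta:(0,\infty)\to[0,\infty)$ with $\beta(s)\to0$ as $s\to\infty$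 such that $\|f\|_2^2\le s\,\mathcal E(T,f)+\beta(s)\,\|f\|_{\mathrm{osc}}^2$ for all $s>0$ and $f\in L^2_0(\mu)$ (with $0\cdot\infty=0$). A bounded operator $S$ on $L^2(\mu)$ is uniform-positivity-improving (UPI) if for every $\varepsilon>0$ $$\inf\{\langle\mathbf 1_A,S\mathbf 1_B\rangle:\ A,B\in\mathscr E,\ \mu(A)\wedge\mu(B)\ge\varepsilon\}>0\qquad(\inf\emptyset=\infty).$$ The kernel $T$ is resolvent-uniform-positivity-improving (RUPI) if for some $\lambda\in(0,1)$ the resolvent $R(\lambda,T)=\sum_{n=0}^\infty\lambda^nT^n=(\mathrm{Id}-\lambda T)^{-1}$ is UPI. **Theorem.** $T$ satisfies a $\|\cdot\|_{\mathrm{osc}}^2$-WPI if and only if $T$ is RUPI, and this holds for either form of the WPI: $T$ satisfies one in the $\alpha$-form if and only if $T$ is RUPI, and $T$ satisfies one in the $\beta$-form if and only if $T$ is RUPI. Moreover, $T$ is RUPI if and only if $R(\lambda,T)$ is UPI for all $\lambda\in(0,1)$. -/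

import Mathlib

open MeasureTheory ProbabilityTheory Filter Set Topology
open scoped ENNReal

noncomputable section

namespace WeakPoincare

variable {E : Type*} [MeasurableSpace E] {μ : Measure E}

section MarkovOperator

variable {T : Kernel E E}

/-- Functions that agree `μ`-a.e. agree `T x`-a.e. for `μ`-a.e. `x`, when `μ` is `T`-invariant. -/
theorem ae_ae_of_invariant (hT : T.Invariant μ) {p : E → Prop} (h : ∀ᵐ y ∂μ, p y) :
    ∀ᵐ x ∂μ, ∀ᵐ y ∂(T x), p y := by
  refine Measure.ae_ae_of_ae_bind (Kernel.aemeasurable T) ?_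
  rw [hT.def]
  exact h

theorem lintegral_eLpNorm_sq (hT : T.Invariant μ) {f : E → ℝ} (hf : Measurable f) :
    ∫⁻ x, (eLpNorm f 2 (T x)) ^ 2 ∂μ = (eLpNorm f 2 μ) ^ 2 := by
  have key : ∀ ν : Measure E, (eLpNorm f 2 ν) ^ 2 = ∫⁻ y, ‖f y‖ₑ ^ 2 ∂ν := fun ν => by
    simpa using eLpNorm_nnreal_pow_eq_lintegral (f := f) (μ := ν) (p := 2) (by norm_num)
  simp_rw [key]
  rw [← Measure.lintegral_bind (m := μ) (μ := T) (f := fun y => ‖f y‖ₑ ^ 2)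
    (Kernel.aemeasurable T) (by fun_prop), hT.def]

theorem ae_memLp (hT : T.Invariant μ) (f : Lp ℝ 2 μ) : ∀ᵐ x ∂μ, MemLp f 2 (T x) := by
  have hm : Measurable f := (Lp.stronglyMeasurable f).measurable
  have hlt : ∫⁻ x, (eLpNorm f 2 (T x)) ^ 2 ∂μ ≠ ∞ := by
    rw [lintegral_eLpNorm_sq hT hm]
    exact ENNReal.pow_ne_top (Lp.eLpNorm_ne_top f)
  have hmeas : Measurable fun x => (eLpNorm f 2 (T x)) ^ 2 := by
    have key : ∀ ν : Measure E, (eLpNorm f 2 ν) ^ 2 = ∫⁻ y, ‖f y‖ₑ ^ 2 ∂ν := fun ν => by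
      simpa using eLpNorm_nnreal_pow_eq_lintegral (f := f) (μ := ν) (p := 2) (by norm_num)
    simp_rw [key]
    exact Measurable.lintegral_kernel (by fun_prop)
  filter_upwards [ae_lt_top hmeas hlt] with x hx
  refine ⟨hm.aestronglyMeasurable, ?_⟩
  by_contra h
  simp only [not_lt, top_le_iff] at h
  simp [h] at hx

variable [IsMarkovKernel T]

theorem ae_integrable (hT : T.Invariant μ) (f : Lp ℝ 2 μ) :
    ∀ᵐ x ∂μ, Integrable f (T x) := by
  filter_upwards [ae_memLp hT f] with x hx
  exact hx.integrable (by norm_num)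

theorem eLpNorm_integral_le (hT : T.Invariant μ) (f : Lp ℝ 2 μ) :
    eLpNorm (fun x => ∫ y, f y ∂(T x)) 2 μ ≤ eLpNorm f 2 μ := by
  have hm : Measurable f := (Lp.stronglyMeasurable f).measurable
  refine (ENNReal.pow_le_pow_left_iff (two_ne_zero)).1 ?_
  have h1 : (eLpNorm (fun x => ∫ y, f y ∂(T x)) 2 μ) ^ 2
      = ∫⁻ x, ‖∫ y, f y ∂(T x)‖ₑ ^ 2 ∂μ := by
    simpa using eLpNorm_nnreal_pow_eq_lintegral (f := fun x => ∫ y, f y ∂(T x)) (μ := μ)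
      (p := 2) (by norm_num)
  rw [h1, ← lintegral_eLpNorm_sq hT hm]
  refine lintegral_mono fun x => ?_
  gcongr
  calc ‖∫ y, f y ∂(T x)‖ₑ ≤ ∫⁻ y, ‖f y‖ₑ ∂(T x) := enorm_integral_le_lintegral_enorm _
    _ = eLpNorm f 1 (T x) := eLpNorm_one_eq_lintegral_enorm.symm
    _ ≤ eLpNorm f 2 (T x) :=
      eLpNorm_le_eLpNorm_of_exponent_le (by norm_num) hm.aestronglyMeasurable

theorem memLp_integral (hT : T.Invariant μ) (f : Lp ℝ 2 μ) :
    MemLp (fun x => ∫ y, f y ∂(T x)) 2 μ :=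
  ⟨(StronglyMeasurable.integral_kernel (Lp.stronglyMeasurable f)).aestronglyMeasurable,
    (eLpNorm_integral_le hT f).trans_lt (Lp.eLpNorm_lt_top f)⟩

/-- The bounded linear operator `(T f)(x) = ∫ f(y) T(x, dy)` on `L²(μ)` that a `μ`-invariant Markov
kernel `T` induces. -/
def markovOp (T : Kernel E E) [IsMarkovKernel T] (μ : Measure E) (hT : T.Invariant μ) :
    Lp ℝ 2 μ →L[ℝ] Lp ℝ 2 μ :=
  LinearMap.mkContinuous
    { toFun := fun f => (memLp_integral hT f).toLp (fun x => ∫ y, f y ∂(T x))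
      map_add' := fun f g => by
        rw [← MemLp.toLp_add, MemLp.toLp_eq_toLp_iff]
        filter_upwards [ae_ae_of_invariant hT (Lp.coeFn_add f g), ae_integrable hT f,
          ae_integrable hT g] with x hx hf hg
        rw [integral_congr_ae hx]
        exact integral_add hf hg
      map_smul' := fun c f => by
        rw [RingHom.id_apply, ← MemLp.toLp_const_smul, MemLp.toLp_eq_toLp_iff]
        filter_upwards [ae_ae_of_invariant hT (Lp.coeFn_smul c f)] with x hx
        rw [integral_congr_ae hx]
        exact integral_smul c _ }
    1 (fun f => by
      rw [one_mul]
      change ‖(memLp_integral hT f).toLp _‖ ≤ ‖f‖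
      rw [Lp.norm_toLp, Lp.norm_def]
      exact ENNReal.toReal_mono (Lp.eLpNorm_ne_top f) (eLpNorm_integral_le hT f))

theorem coeFn_markovOp (hT : T.Invariant μ) (f : Lp ℝ 2 μ) :
    markovOp T μ hT f =ᵐ[μ] fun x => ∫ y, f y ∂(T x) :=
  MemLp.coeFn_toLp (memLp_integral hT f)

theorem norm_markovOp_le (hT : T.Invariant μ) : ‖markovOp T μ hT‖ ≤ 1 :=
  LinearMap.mkContinuous_norm_le _ zero_le_one _

end MarkovOperator

/-- The oscillation `‖f‖_osc = ess sup f - ess inf f`, in `[0, ∞]`. The essential bounds are taken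
in the extended reals, so that, for a
probability measure `μ`, it is `∞` exactly when `f` is not essentially bounded. -/
def osc (f : Lp ℝ 2 μ) : ℝ≥0∞ :=
  (essSup (fun x => ((f x : ℝ) : EReal)) μ - essInf (fun x => ((f x : ℝ) : EReal)) μ).toENNReal

/-- The functional `Φ = ‖·‖²_osc`. -/
def oscSq (f : Lp ℝ 2 μ) : ℝ≥0∞ := osc f ^ 2

/-- The Dirichlet form `𝓔(S, f) = ⟨(Id - S) f, f⟩`. -/
def dirichlet (S : Lp ℝ 2 μ →L[ℝ] Lp ℝ 2 μ) (f : Lp ℝ 2 μ) : ℝ :=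
  inner ℝ ((1 - S) f) f

/-- The `(Φ, α)`-weak Poincaré inequality: `α : (0, ∞) → [0, ∞)` is decreasing and
`‖f‖² ≤ α(r) 𝓔(S, f) + r Φ(f)` for all `r > 0` and all centred `f ∈ L²(μ)`. -/
def AlphaWPI (Φ : Lp ℝ 2 μ → ℝ≥0∞) (α : ℝ → ℝ) (S : Lp ℝ 2 μ →L[ℝ] Lp ℝ 2 μ) : Prop :=
  (∀ r, 0 < r → 0 ≤ α r) ∧ AntitoneOn α (Ioi 0) ∧
    ∀ r : ℝ, 0 < r → ∀ f : Lp ℝ 2 μ, ∫ x, f x ∂μ = 0 →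
      ((‖f‖ ^ 2 : ℝ) : EReal) ≤ ((α r * dirichlet S f : ℝ) : EReal) + (r : EReal) * (Φ f : EReal)

/-- The `(Φ, β)`-weak Poincaré inequality: `β : (0, ∞) → [0, ∞)` is decreasing, `β(s) → 0` as
`s → ∞`, and `‖f‖² ≤ s 𝓔(S, f) + β(s) Φ(f)` for all `s > 0` and all centred `f ∈ L²(μ)`. -/
def BetaWPI (Φ : Lp ℝ 2 μ → ℝ≥0∞) (β : ℝ → ℝ) (S : Lp ℝ 2 μ →L[ℝ] Lp ℝ 2 μ) : Prop :=
  (∀ s, 0 < s → 0 ≤ β s) ∧ AntitoneOn β (Ioi 0) ∧ Tendsto β atTop (𝓝 0) ∧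
    ∀ s : ℝ, 0 < s → ∀ f : Lp ℝ 2 μ, ∫ x, f x ∂μ = 0 →
      ((‖f‖ ^ 2 : ℝ) : EReal) ≤ ((s * dirichlet S f : ℝ) : EReal) + (β s : EReal) * (Φ f : EReal)

/-- The resolvent `R(l, S) = ∑ₙ lⁿ Sⁿ`, a series of bounded operators. -/
def resolventOp (l : ℝ) (S : Lp ℝ 2 μ →L[ℝ] Lp ℝ 2 μ) : Lp ℝ 2 μ →L[ℝ] Lp ℝ 2 μ :=
  ∑' n : ℕ, l ^ n • S ^ n

/-- For a contraction the resolvent series converges in operator norm. -/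
theorem summable_resolventOp {S : Lp ℝ 2 μ →L[ℝ] Lp ℝ 2 μ} (hS : ‖S‖ ≤ 1) {l : ℝ}
    (h0 : 0 < l) (h1 : l < 1) : Summable fun n : ℕ => l ^ n • S ^ n := by
  refine Summable.of_norm_bounded_eventually_nat (summable_geometric_of_lt_one h0.le h1) ?_
  filter_upwards [eventually_gt_atTop 0] with n hn
  rw [norm_smul, Real.norm_of_nonneg (pow_nonneg h0.le n)]
  calc l ^ n * ‖S ^ n‖ ≤ l ^ n * 1 := by
        gcongr
        exact (norm_pow_le' S hn).trans (pow_le_one₀ (norm_nonneg _) hS)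
    _ = l ^ n := mul_one _

/-- The class in `L²(μ)` of the indicator function of a measurable set. -/
def ind [IsFiniteMeasure μ] {A : Set E} (hA : MeasurableSet A) : Lp ℝ 2 μ :=
  indicatorConstLp 2 hA (measure_ne_top μ A) (1 : ℝ)

/-- An operator `S` on `L²(μ)` is uniform-positivity-improving if, for each `ε > 0`, the infimum of
`⟨1_A, S 1_B⟩` over measurable `A, B` with `μ(A) ∧ μ(B) ≥ ε` is positive (`inf ∅ = ∞`). -/
def IsUPI [IsFiniteMeasure μ] (S : Lp ℝ 2 μ →L[ℝ] Lp ℝ 2 μ) : Prop :=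
  ∀ ε : ℝ, 0 < ε → ∃ δ : ℝ, 0 < δ ∧ ∀ (A B : Set E) (hA : MeasurableSet A) (hB : MeasurableSet B),
    ε ≤ min (μ.real A) (μ.real B) → δ ≤ inner ℝ (ind (μ := μ) hA) (S (ind hB))

/-- Resolvent-uniform-positivity-improving: `R(l, S)` is uniform-positivity-improving for some
`0 < l < 1`. -/
def IsRUPI [IsFiniteMeasure μ] (S : Lp ℝ 2 μ →L[ℝ] Lp ℝ 2 μ) : Prop :=
  ∃ l : ℝ, 0 < l ∧ l < 1 ∧ IsUPI (resolventOp l S)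

end WeakPoincare

end

/-! Both forms of the inequality are equivalent to `OscWPI`, so it suffices to pass from UPI of one
resolvent to `OscWPI`, and from `OscWPI` to UPI of every resolvent. Write `P = (1 - l) R(l, T)`, a
positive operator preserving constants and integrals.

From UPI to `OscWPI` (`OscWPI.of_isUPI_resolventOp`): let `f` be centred with oscillation at most
`M` and `‖f‖² > r M²`. Then `A = {f ≤ 0}` and `B = {f ≥ r M / 4}` both have mass at least `r / 4`,
so UPI makes `P` carry a fixed amount of mass between them. By `mul_inner_ind_le` this forces `‖f -
P f‖` to be at least a multiple of `M`. Since `f - P f = l R (f - T f)` and `‖f - T f‖² ≤ 2 𝓔(T,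
f)`, the energy controls `M²`, hence `‖f‖²`.

From `OscWPI` to UPI (`OscWPI.isUPI_resolventOp`): if `⟨1_A, R 1_B⟩` is below a tiny `a`, test the
inequality on the centred logarithm of `g + a`, where `g = P 1_B`. As `g + a` is `l`-excessive,
`dirichlet_log_le` bounds the energy linearly in `M ≈ log (1 / a)`. But the logarithm is about `-M`
on average over `A` and bounded below on `B`, so its squared norm is at least about `ε M² / 4`. This
beats the energy plus `ε M² / 16` once `M` is large. Reversibility is never needed. -/

namespace WeakPoincare

variable {E : Type*} [MeasurableSpace E] {μ : Measure E}

/-! ### Positivity, constants and integrals under the Markov operator. -/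

section Markov

variable {T : Kernel E E}

theorem integral_integral_of_invariant (hT : T.Invariant μ) {f : E → ℝ}
    (hf : Integrable f μ) : ∫ x, ∫ y, f y ∂(T x) ∂μ = ∫ x, f x ∂μ := by
  rw [← hT.def, Measure.comp_eq_comp_const_apply] at hf
  simpa [← Measure.comp_eq_comp_const_apply, hT.def] using (Kernel.integral_comp hf).symm

variable [IsMarkovKernel T]

theorem markovOp_nonneg (hT : T.Invariant μ) {f : Lp ℝ 2 μ} (hf : 0 ≤ f) :
    0 ≤ markovOp T μ hT f := by
  rw [← Lp.coeFn_nonneg] at hf ⊢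
  filter_upwards [coeFn_markovOp hT f, ae_ae_of_invariant hT hf] with x hx hx'
  rw [hx]
  exact integral_nonneg_of_ae hx'

theorem markovOp_const [IsProbabilityMeasure μ] (hT : T.Invariant μ) (c : ℝ) :
    markovOp T μ hT (Lp.const 2 μ c) = Lp.const 2 μ c := by
  apply Lp.ext
  filter_upwards [coeFn_markovOp hT (Lp.const 2 μ c), Lp.coeFn_const (p := 2) (μ := μ) c,
    ae_ae_of_invariant hT (Lp.coeFn_const (p := 2) (μ := μ) c)] with x h1 h2 h3
  rw [h1, h2, integral_congr_ae h3]
  simp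

theorem integral_markovOp [IsProbabilityMeasure μ] (hT : T.Invariant μ) (f : Lp ℝ 2 μ) :
    ∫ x, markovOp T μ hT f x ∂μ = ∫ x, f x ∂μ := by
  rw [integral_congr_ae (coeFn_markovOp hT f)]
  exact integral_integral_of_invariant hT ((Lp.memLp f).integrable (by norm_num))

end Markov

/-! ### Contractions and their resolvents. -/

section Contraction

variable {S : Lp ℝ 2 μ →L[ℝ] Lp ℝ 2 μ}

/-- Expand the square and use `‖S f‖ ≤ ‖f‖`; this replaces the spectral calculus of the reversible
case. -/
theorem norm_sub_apply_sq_le (hS : ‖S‖ ≤ 1) (f : Lp ℝ 2 μ) :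
    ‖f - S f‖ ^ 2 ≤ 2 * dirichlet S f := by
  have h : ‖S f‖ ≤ ‖f‖ := by
    simpa using S.le_of_opNorm_le hS f
  have h2 : ‖S f‖ ^ 2 ≤ ‖f‖ ^ 2 := by gcongr
  have h3 : dirichlet S f = ‖f‖ ^ 2 - inner ℝ f (S f) := by
    simp [dirichlet, inner_sub_left, real_inner_comm]
  rw [norm_sub_sq_real, h3]
  linarith

theorem dirichlet_nonneg (hS : ‖S‖ ≤ 1) (f : Lp ℝ 2 μ) : 0 ≤ dirichlet S f := by
  have := norm_sub_apply_sq_le hS f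
  nlinarith [sq_nonneg ‖f - S f‖]

variable {l : ℝ}

theorem resolventOp_eq_tsum_pow (l : ℝ) (S : Lp ℝ 2 μ →L[ℝ] Lp ℝ 2 μ) :
    resolventOp l S = ∑' n : ℕ, (l • S) ^ n := by
  simp [resolventOp, smul_pow]

theorem norm_smul_lt_one (hS : ‖S‖ ≤ 1) (h0 : 0 < l) (h1 : l < 1) : ‖l • S‖ < 1 := by
  rw [norm_smul, Real.norm_of_nonneg h0.le]
  nlinarith [norm_nonneg S]

theorem resolventOp_apply_sub (hS : ‖S‖ ≤ 1) (h0 : 0 < l) (h1 : l < 1) (f : Lp ℝ 2 μ) :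
    resolventOp l S f - l • resolventOp l S (S f) = f := by
  have h := geom_series_mul_neg (l • S)
    (norm_smul_lt_one hS h0 h1)
  rw [← resolventOp_eq_tsum_pow] at h
  simpa using congrArg (fun U : Lp ℝ 2 μ →L[ℝ] Lp ℝ 2 μ => U f) h

theorem sub_apply_resolventOp (hS : ‖S‖ ≤ 1) (h0 : 0 < l) (h1 : l < 1) (f : Lp ℝ 2 μ) :
    resolventOp l S f - l • S (resolventOp l S f) = f := by
  have h := mul_neg_geom_series (l • S)
    (norm_smul_lt_one hS h0 h1)
  rw [← resolventOp_eq_tsum_pow] at h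
  simpa using congrArg (fun U : Lp ℝ 2 μ →L[ℝ] Lp ℝ 2 μ => U f) h

theorem resolventOp_nonneg (hS : ‖S‖ ≤ 1) (h0 : 0 < l) (h1 : l < 1)
    (hpos : ∀ f, 0 ≤ f → 0 ≤ S f) {f : Lp ℝ 2 μ} (hf : 0 ≤ f) : 0 ≤ resolventOp l S f := by
  have hsum := (summable_resolventOp hS h0 h1).hasSum.mapL
    (ContinuousLinearMap.apply ℝ (Lp ℝ 2 μ) f)
  have hpow : ∀ n : ℕ, 0 ≤ (S ^ n) f := by
    intro n
    induction n with
    | zero => simpa using hf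
    | succ n ih => rw [pow_succ']; exact hpos _ ih
  refine hsum.nonneg fun n => ?_
  simp only [ContinuousLinearMap.apply_apply, _root_.smul_apply]
  rw [← Lp.coeFn_nonneg]
  filter_upwards [(Lp.coeFn_nonneg _).2 (hpow n), Lp.coeFn_smul (l ^ n) ((S ^ n) f)] with x hx hx'
  rw [hx']
  exact mul_nonneg (pow_nonneg h0.le n) hx

theorem integral_resolventOp [IsProbabilityMeasure μ] (hS : ‖S‖ ≤ 1) (h0 : 0 < l) (h1 : l < 1)
    (hint : ∀ f : Lp ℝ 2 μ, ∫ x, S f x ∂μ = ∫ x, f x ∂μ) (f : Lp ℝ 2 μ) :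
    (1 - l) * ∫ x, resolventOp l S f x ∂μ = ∫ x, f x ∂μ := by
  set g := resolventOp l S f with hg
  have h := sub_apply_resolventOp hS h0 h1 f
  rw [← hg] at h
  have hi : ∀ u : Lp ℝ 2 μ, Integrable u μ := fun u => (Lp.memLp u).integrable (by norm_num)
  have h2 : ∫ x, f x ∂μ = ∫ x, (g x - l * S g x) ∂μ := by
    refine integral_congr_ae ?_
    nth_rw 1 [← h]
    filter_upwards [Lp.coeFn_sub g (l • S g), Lp.coeFn_smul l (S g)] with x hx hx'
    rw [hx, Pi.sub_apply, hx', Pi.smul_apply, smul_eq_mul]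
  rw [h2, integral_sub (hi _) ((hi _).const_mul _), integral_const_mul, hint]
  ring

/-- `Id - (1 - l) R(l, S) = l R(l, S) (Id - S)`. -/
theorem sub_smul_resolventOp (hS : ‖S‖ ≤ 1) (h0 : 0 < l) (h1 : l < 1) (f : Lp ℝ 2 μ) :
    f - (1 - l) • resolventOp l S f = l • resolventOp l S (f - S f) := by
  have h := resolventOp_apply_sub hS h0 h1 f
  rw [map_sub]
  nth_rw 1 [← h]
  module

end Contraction

end WeakPoincare

/-! ### Oscillation, and the reduction of both inequalities to `OscWPI`. -/

namespace WeakPoincare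

variable {E : Type*} [MeasurableSpace E] {μ : Measure E}

section Oscillation

theorem osc_le_ofReal {f : Lp ℝ 2 μ} {c M : ℝ} (h : ∀ᵐ x ∂μ, c ≤ f x ∧ f x ≤ c + M) :
    osc f ≤ ENNReal.ofReal M := by
  have h1 : essSup (fun x => ((f x : ℝ) : EReal)) μ ≤ ((c + M : ℝ) : EReal) :=
    essSup_le_of_ae_le _ (h.mono fun x hx => EReal.coe_le_coe_iff.2 hx.2)
  have h2 : (c : EReal) ≤ essInf (fun x => ((f x : ℝ) : EReal)) μ :=
    le_essInf_of_ae_le _ (h.mono fun x hx => EReal.coe_le_coe_iff.2 hx.1)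
  have h3 := EReal.sub_le_sub h1 h2
  rw [← EReal.coe_sub, add_sub_cancel_left] at h3
  have h4 := EReal.toENNReal_le_toENNReal h3
  rwa [EReal.toENNReal_of_ne_top (EReal.coe_ne_top M), EReal.toReal_coe] at h4

theorem exists_bounds_of_osc_ne_top [IsProbabilityMeasure μ] {f : Lp ℝ 2 μ} (h : osc f ≠ ∞) :
    ∃ c, ∀ᵐ x ∂μ, c ≤ f x ∧ f x ≤ c + (osc f).toReal := by
  have hsup := ae_le_essSup (f := fun x => ((f x : ℝ) : EReal)) (μ := μ)
  have hinf := ae_essInf_le (f := fun x => ((f x : ℝ) : EReal)) (μ := μ)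
  unfold osc at h ⊢
  generalize essSup (fun x => ((f x : ℝ) : EReal)) μ = b at *
  generalize essInf (fun x => ((f x : ℝ) : EReal)) μ = a at *
  -- The real value at one such point excludes `a = ⊤` and `b = ⊥`; the other infinite cases make
  -- the oscillation infinite.
  obtain ⟨x, hx, hx'⟩ := (hsup.and hinf).exists
  induction a with
  | bot =>
    have hb : b ≠ ⊥ := by
      rintro rfl
      simp at hx
    simp [sub_eq_add_neg, EReal.add_top_of_ne_bot hb] at h
  | top => simp at hx'
  | coe a =>
    induction b with
    | bot => simp at hx
    | top => simp_all
    | coe b =>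
      refine ⟨a, ?_⟩
      filter_upwards [hsup, hinf] with y hy hy'
      rw [EReal.coe_le_coe_iff] at hy hy'
      rw [← EReal.coe_sub, EReal.toENNReal_of_ne_top (EReal.coe_ne_top _), EReal.toReal_coe,
        ENNReal.toReal_ofReal (by linarith)]
      exact ⟨hy', by linarith⟩

theorem coe_oscSq {f : Lp ℝ 2 μ} (h : osc f ≠ ∞) :
    (oscSq f : EReal) = (((osc f).toReal ^ 2 : ℝ) : EReal) := by
  rw [oscSq, EReal.coe_ennreal_pow, EReal.coe_pow, EReal.coe_ennreal_toReal h]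

theorem le_of_le_add_mul_oscSq [IsProbabilityMeasure μ] {f : Lp ℝ 2 μ} {a K r c M : ℝ}
    (hr : 0 ≤ r) (h : (a : EReal) ≤ (K : EReal) + (r : EReal) * (oscSq f : EReal))
    (hf : ∀ᵐ x ∂μ, c ≤ f x ∧ f x ≤ c + M) : a ≤ K + r * M ^ 2 := by
  have hM : 0 ≤ M := by
    obtain ⟨x, hx⟩ := hf.exists
    linarith
  have ho := osc_le_ofReal hf
  have h1 : (oscSq f : EReal) ≤ ((M ^ 2 : ℝ) : EReal) := by
    rw [coe_oscSq (ne_top_of_le_ne_top ENNReal.ofReal_ne_top ho), EReal.coe_le_coe_iff]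
    gcongr
    exact ENNReal.toReal_le_of_le_ofReal hM ho
  have h2 := h.trans (add_le_add_right (mul_le_mul_of_nonneg_left h1 (EReal.coe_nonneg.2 hr)) _)
  exact_mod_cast h2

/-- Strict positivity of `r` matters: it makes the right side `∞` when the oscillation is infinite,
whereas `0 * ∞ = 0`. -/
theorem le_add_mul_oscSq [IsProbabilityMeasure μ] {f : Lp ℝ 2 μ} {a K r : ℝ} (hr : 0 < r)
    (h : ∀ c M : ℝ, (∀ᵐ x ∂μ, c ≤ f x ∧ f x ≤ c + M) → a ≤ K + r * M ^ 2) :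
    (a : EReal) ≤ (K : EReal) + (r : EReal) * (oscSq f : EReal) := by
  by_cases htop : osc f = ∞
  · simp [oscSq, htop, EReal.coe_mul_top_of_pos hr]
  · obtain ⟨c, hc⟩ := exists_bounds_of_osc_ne_top htop
    have h1 := h c _ hc
    rw [coe_oscSq htop]
    exact_mod_cast h1

end Oscillation

/-- The weak Poincaré inequality for `‖·‖²_osc`, for real-valued oscillation bounds and with no
monotonicity required of the constants. -/
def OscWPI (S : Lp ℝ 2 μ →L[ℝ] Lp ℝ 2 μ) : Prop :=
  ∀ r : ℝ, 0 < r → ∃ C : ℝ, 0 ≤ C ∧ ∀ f : Lp ℝ 2 μ, ∫ x, f x ∂μ = 0 →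
    ∀ c M : ℝ, (∀ᵐ x ∂μ, c ≤ f x ∧ f x ≤ c + M) → ‖f‖ ^ 2 ≤ C * dirichlet S f + r * M ^ 2

/-- The mean `0` must lie in `[c, c + M]`. -/
theorem abs_le_of_integral_eq_zero [IsProbabilityMeasure μ] {f : E → ℝ} (hi : Integrable f μ)
    (h0 : ∫ x, f x ∂μ = 0) {c M : ℝ} (hf : ∀ᵐ x ∂μ, c ≤ f x ∧ f x ≤ c + M) :
    ∀ᵐ x ∂μ, |f x| ≤ M := by
  have h1 : c ≤ 0 := by
    have := integral_mono_ae (integrable_const c) hi (hf.mono fun x hx => hx.1)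
    simpa [h0] using this
  have h2 : 0 ≤ c + M := by
    have := integral_mono_ae hi (integrable_const (c + M)) (hf.mono fun x hx => hx.2)
    simpa [h0] using this
  filter_upwards [hf] with x hx
  exact abs_le.2 ⟨by linarith, by linarith⟩

theorem norm_sq_eq_integral (f : Lp ℝ 2 μ) : ‖f‖ ^ 2 = ∫ x, f x ^ 2 ∂μ := by
  rw [← real_inner_self_eq_norm_sq, L2.inner_def]
  refine integral_congr_ae (Eventually.of_forall fun x => ?_)
  simp [pow_two]

theorem integrable_sq (f : Lp ℝ 2 μ) : Integrable (fun x => f x ^ 2) μ :=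
  (Lp.memLp f).integrable_sq

theorem norm_sq_le_of_integral_eq_zero [IsProbabilityMeasure μ] {f : Lp ℝ 2 μ}
    (h0 : ∫ x, f x ∂μ = 0) {c M : ℝ} (hf : ∀ᵐ x ∂μ, c ≤ f x ∧ f x ≤ c + M) :
    ‖f‖ ^ 2 ≤ M ^ 2 := by
  have hi : Integrable f μ := (Lp.memLp f).integrable (by norm_num)
  rw [norm_sq_eq_integral]
  have h1 := integral_mono_ae (integrable_sq f) (integrable_const (M ^ 2))
    ((abs_le_of_integral_eq_zero hi h0 hf).mono fun x hx => by
      have := pow_le_pow_left₀ (abs_nonneg _) hx 2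
      rwa [sq_abs] at this)
  simpa using h1

variable [IsProbabilityMeasure μ] {S : Lp ℝ 2 μ →L[ℝ] Lp ℝ 2 μ}

theorem OscWPI.of_alphaWPI {α : ℝ → ℝ} (h : AlphaWPI oscSq α S) : OscWPI S := fun r hr =>
  ⟨α r, h.1 r hr, fun f hf _ _ hc => le_of_le_add_mul_oscSq hr.le (h.2.2 r hr f hf) hc⟩

theorem OscWPI.of_betaWPI {β : ℝ → ℝ} (h : BetaWPI oscSq β S) : OscWPI S := by
  intro r hr
  obtain ⟨h0, -, hlim, hb⟩ := h
  obtain ⟨s, hs, hs'⟩ := ((hlim.eventually (gt_mem_nhds hr)).and (eventually_gt_atTop 0)).exists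
  refine ⟨s, hs'.le, fun f hf c M hc => ?_⟩
  have h1 := le_of_le_add_mul_oscSq (h0 s hs') (hb s hs' f hf) hc
  nlinarith [sq_nonneg M]

/-- The infimum of admissible constants is automatically monotone in `r`; adding `1` avoids asking
whether it is attained. -/
theorem OscWPI.exists_alphaWPI (hS : ‖S‖ ≤ 1) (h : OscWPI S) : ∃ α, AlphaWPI oscSq α S := by
  let K : ℝ → Set ℝ := fun r => {C | 0 ≤ C ∧ ∀ f : Lp ℝ 2 μ, ∫ x, f x ∂μ = 0 →
    ∀ c M : ℝ, (∀ᵐ x ∂μ, c ≤ f x ∧ f x ≤ c + M) → ‖f‖ ^ 2 ≤ C * dirichlet S f + r * M ^ 2}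
  have hbdd : ∀ r, BddBelow (K r) := fun r => ⟨0, fun C hC => hC.1⟩
  have hnn : ∀ r, 0 ≤ sInf (K r) := fun r => Real.sInf_nonneg fun C hC => hC.1
  refine ⟨fun r => sInf (K r) + 1, fun r _ => by linarith [hnn r], ?_, ?_⟩
  · intro r hr r' hr' hrr
    refine add_le_add_left (csInf_le_csInf (hbdd r') (h r hr) fun C hC => ⟨hC.1, ?_⟩) 1
    intro f hf c M hc
    nlinarith [hC.2 f hf c M hc, sq_nonneg M]
  · intro r hr f hf
    refine le_add_mul_oscSq hr fun c M hc => ?_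
    obtain ⟨C, hC, hlt⟩ := exists_lt_of_csInf_lt (h r hr) (lt_add_one (sInf (K r)))
    nlinarith [hC.2 f hf c M hc, dirichlet_nonneg hS f]

theorem OscWPI.exists_betaWPI (hS : ‖S‖ ≤ 1) (h : OscWPI S) : ∃ β, BetaWPI oscSq β S := by
  let K : ℝ → Set ℝ := fun s => {r | 0 ≤ r ∧ ∀ f : Lp ℝ 2 μ, ∫ x, f x ∂μ = 0 →
    ∀ c M : ℝ, (∀ᵐ x ∂μ, c ≤ f x ∧ f x ≤ c + M) → ‖f‖ ^ 2 ≤ s * dirichlet S f + r * M ^ 2}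
  have hbdd : ∀ s, BddBelow (K s) := fun s => ⟨0, fun r hr => hr.1⟩
  have hnn : ∀ s, 0 ≤ sInf (K s) := fun s => Real.sInf_nonneg fun r hr => hr.1
  have hne : ∀ s, 0 < s → (K s).Nonempty := fun s hs => by
    refine ⟨1, zero_le_one, fun f hf c M hc => ?_⟩
    nlinarith [norm_sq_le_of_integral_eq_zero hf hc, mul_nonneg hs.le (dirichlet_nonneg hS f)]
  have hmono : ∀ s s', s ≤ s' → K s ⊆ K s' := fun s s' hss r hr => by
    refine ⟨hr.1, fun f hf c M hc => ?_⟩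
    nlinarith [hr.2 f hf c M hc, dirichlet_nonneg hS f]
  have hinv : ∀ s : ℝ, 0 < s → 0 < s⁻¹ := fun s hs => inv_pos.2 hs
  -- The margin `s⁻¹` is decreasing and vanishes at infinity. It keeps `β` positive, as infinite
  -- oscillation requires, and leaves an admissible constant below `β s`.
  refine ⟨fun s => sInf (K s) + s⁻¹, fun s hs => by linarith [hnn s, hinv s hs], ?_, ?_, ?_⟩
  · intro s hs s' hs' hss
    exact add_le_add (csInf_le_csInf (hbdd s') (hne s hs) (hmono s s' hss)) (inv_anti₀ hs hss)
  · have hK : Tendsto (fun s => sInf (K s)) atTop (𝓝 0) := by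
      rw [Metric.tendsto_atTop]
      intro e he
      obtain ⟨C, -, hC⟩ := h (e / 2) (by linarith)
      refine ⟨C, fun s hs => ?_⟩
      have h1 : sInf (K s) ≤ e / 2 :=
        csInf_le (hbdd s) (hmono C s hs ⟨by linarith, hC⟩)
      rw [Real.dist_0_eq_abs, abs_of_nonneg (hnn s)]
      linarith
    simpa using hK.add tendsto_inv_atTop_zero
  · intro s hs f hf
    refine le_add_mul_oscSq (by linarith [hnn s, hinv s hs]) fun c M hc => ?_
    obtain ⟨r, hr, hlt⟩ := exists_lt_of_csInf_lt (hne s hs)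
      (lt_add_of_pos_right (sInf (K s)) (hinv s hs))
    nlinarith [hr.2 f hf c M hc, sq_nonneg M]

end WeakPoincare

/-! ### From a UPI resolvent to the weak Poincaré inequality. -/

namespace WeakPoincare

variable {E : Type*} [MeasurableSpace E] {μ : Measure E} [IsProbabilityMeasure μ]

theorem integrable_coeFn (f : Lp ℝ 2 μ) : Integrable f μ :=
  (Lp.memLp f).integrable (by norm_num)

theorem integral_abs_le_norm (f : Lp ℝ 2 μ) : ∫ x, |f x| ∂μ ≤ ‖f‖ := by
  simp_rw [← Real.norm_eq_abs]
  rw [integral_norm_eq_lintegral_enorm (Lp.aestronglyMeasurable f),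
    ← eLpNorm_one_eq_lintegral_enorm, Lp.norm_def]
  exact ENNReal.toReal_mono (Lp.eLpNorm_ne_top f)
    (eLpNorm_le_eLpNorm_of_exponent_le (by norm_num) (Lp.aestronglyMeasurable f))

theorem inner_ind {A : Set E} (hA : MeasurableSet A) (f : Lp ℝ 2 μ) :
    inner ℝ (ind (μ := μ) hA) f = ∫ x in A, f x ∂μ :=
  L2.inner_indicatorConstLp_one hA (measure_ne_top μ A) f

theorem coeFn_ind {A : Set E} (hA : MeasurableSet A) :
    ind (μ := μ) hA =ᵐ[μ] A.indicator fun _ => (1 : ℝ) :=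
  indicatorConstLp_coeFn

/-- If a positive, integral-preserving operator `P` almost fixes `f`, then it transports little mass
from `{f ≥ c}` to `{f ≤ 0}`. -/
theorem mul_inner_ind_le {P : Lp ℝ 2 μ →L[ℝ] Lp ℝ 2 μ} (hpos : ∀ f, 0 ≤ f → 0 ≤ P f)
    (hint : ∀ f : Lp ℝ 2 μ, ∫ x, P f x ∂μ = ∫ x, f x ∂μ) (f : Lp ℝ 2 μ) (c : ℝ)
    {A B : Set E} (hA : MeasurableSet A) (hB : MeasurableSet B) (hfA : ∀ x, x ∈ A ↔ f x ≤ 0)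
    (hfB : ∀ x ∈ B, c ≤ f x) :
    c * inner ℝ (ind (μ := μ) hA) (P (ind hB)) ≤ ‖f - P f‖ := by
  have hmono : ∀ u v : Lp ℝ 2 μ, u ≤ v → P u ≤ P v := fun u v huv => by
    have := hpos _ (sub_nonneg.2 huv)
    rwa [map_sub, sub_nonneg] at this
  set p : Lp ℝ 2 μ := f ⊔ 0 with hp
  have hpf : p =ᵐ[μ] fun x => max (f x) 0 := by
    filter_upwards [Lp.coeFn_sup f 0, Lp.coeFn_zero ℝ 2 μ] with x hx h0
    rw [hx, Pi.sup_apply, h0, Pi.zero_apply]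
  have hBp : c • ind hB ≤ p := by
    rw [← Lp.coeFn_le]
    filter_upwards [hpf, Lp.coeFn_smul c (ind (μ := μ) hB), coeFn_ind (μ := μ) hB] with x h1 h2 h3
    rw [h1, h2, Pi.smul_apply, h3, smul_eq_mul]
    by_cases hx : x ∈ B
    · simp [hx, hfB x hx]
    · simp [hx]
  have h1 := hmono _ _ hBp
  have h2 := hmono _ _ (le_sup_left : f ≤ p)
  have h3 := hpos _ (le_sup_right : 0 ≤ p)
  rw [map_smul] at h1
  rw [← Lp.coeFn_le] at h1 h2
  rw [← Lp.coeFn_nonneg] at h3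
  -- On `A`, `p = 0` and `P p ≥ c P 1_B`; off `A`, `p = f` and `P p ≥ P f`. The term `P p - p`
  -- integrates to zero.
  have key : ∀ᵐ x ∂μ, A.indicator (fun x => c * P (ind hB) x) x ≤ (P p x - p x) + |(f - P f) x| := by
    filter_upwards [h1, h2, h3, hpf, Lp.coeFn_smul c (P (ind (μ := μ) hB)), Lp.coeFn_sub f (P f)]
      with x h1 h2 h3 hx hs hd
    rw [hs, Pi.smul_apply, smul_eq_mul] at h1
    rw [hd, Pi.sub_apply, hx]
    by_cases hxA : x ∈ A
    · rw [indicator_of_mem hxA, max_eq_right ((hfA x).1 hxA)]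
      linarith [abs_nonneg (f x - P f x)]
    · rw [indicator_of_notMem hxA, max_eq_left (not_le.1 fun h => hxA ((hfA x).2 h)).le]
      linarith [le_abs_self (f x - P f x)]
  have hI := integral_mono_ae (((integrable_coeFn (P (ind hB))).const_mul c).indicator hA)
    (((integrable_coeFn (P p)).sub (integrable_coeFn p)).add (integrable_coeFn (f - P f)).abs) key
  rw [integral_indicator hA, integral_const_mul, ← inner_ind hA] at hI
  refine hI.trans ?_
  rw [integral_add' ((integrable_coeFn (P p)).sub (integrable_coeFn p))
    (integrable_coeFn (f - P f)).abs, integral_sub' (integrable_coeFn _) (integrable_coeFn _),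
    hint, sub_self, zero_add]
  exact integral_abs_le_norm _

/-- A centred function bounded by `M` with `‖f‖₂² ≥ r M²` is nonpositive, and is at least `r M / 4`,
on sets of measure bounded below. -/
theorem le_measureReal_of_norm_sq {f : Lp ℝ 2 μ} (h0 : ∫ x, f x ∂μ = 0) {r M : ℝ} (hr : 0 < r)
    (hM : 0 < M) (hf : ∀ᵐ x ∂μ, |f x| ≤ M) (hn : r * M ^ 2 ≤ ‖f‖ ^ 2) {A B : Set E}
    (hA : MeasurableSet A) (hB : MeasurableSet B) (hfA : ∀ x, x ∈ A ↔ f x ≤ 0)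
    (hfB : ∀ x, x ∈ B ↔ r * M / 4 ≤ f x) : r / 4 ≤ min (μ.real A) (μ.real B) := by
  have hi := integrable_coeFn f
  have habs : r * M ≤ ∫ x, |f x| ∂μ := by
    have h1 : ∫ x, f x ^ 2 ∂μ ≤ ∫ x, M * |f x| ∂μ := by
      refine integral_mono_ae (integrable_sq f) (hi.abs.const_mul M) (hf.mono fun x hx => ?_)
      dsimp only
      rw [← sq_abs]
      nlinarith [abs_nonneg (f x)]
    rw [integral_const_mul, ← norm_sq_eq_integral] at h1
    refine le_of_mul_le_mul_left ?_ hM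
    linarith
  have hind : ∀ {C : Set E}, MeasurableSet C → ∀ a : ℝ,
      ∫ x, C.indicator (fun _ => a) x ∂μ = μ.real C * a := fun hC a => by
    rw [integral_indicator_const a hC, smul_eq_mul]
  have hindi : ∀ {C : Set E}, MeasurableSet C → ∀ a : ℝ,
      Integrable (C.indicator fun _ => a) μ := fun hC a => (integrable_const a).indicator hC
  refine le_min ?_ ?_
  -- As `f` is centred, `|f| - f` and `|f| + f` both have integral `∫ |f| ≥ r M`. The first vanishes
  -- off `A`, the second is at most `r M / 2` off `B`.
  · have h1 : ∫ x, (|f x| - f x) ∂μ ≤ ∫ x, A.indicator (fun _ => 2 * M) x ∂μ := by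
      refine integral_mono_ae (hi.abs.sub hi) (hindi hA _) (hf.mono fun x hx => ?_)
      dsimp only
      by_cases hxA : x ∈ A
      · rw [indicator_of_mem hxA]
        linarith [neg_abs_le (f x)]
      · rw [indicator_of_notMem hxA, abs_of_pos (not_le.1 fun h => hxA ((hfA x).2 h)), sub_self]
    rw [hind hA, integral_sub hi.abs hi, h0] at h1
    nlinarith
  · have h1 : ∫ x, (|f x| + f x) ∂μ ≤ ∫ x, (B.indicator (fun _ => 2 * M) x + r * M / 2) ∂μ := by
      refine integral_mono_ae (hi.abs.add hi) ((hindi hB _).add (integrable_const _))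
        (hf.mono fun x hx => ?_)
      dsimp only
      have hrM : 0 < r * M := mul_pos hr hM
      by_cases hxB : x ∈ B
      · rw [indicator_of_mem hxB]
        linarith [le_abs_self (f x)]
      · rw [indicator_of_notMem hxB]
        have := not_le.1 fun h => hxB ((hfB x).2 h)
        rcases abs_cases (f x) with ⟨h, -⟩ | ⟨h, -⟩ <;> rw [h] <;> linarith
    rw [integral_add (hindi hB _) (integrable_const _), hind hB, integral_add hi.abs hi, h0] at h1
    simp only [integral_const, probReal_univ, one_smul] at h1
    nlinarith

variable {S : Lp ℝ 2 μ →L[ℝ] Lp ℝ 2 μ}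

theorem OscWPI.of_isUPI_resolventOp (hS : ‖S‖ ≤ 1) (hpos : ∀ f, 0 ≤ f → 0 ≤ S f)
    (hint : ∀ f : Lp ℝ 2 μ, ∫ x, S f x ∂μ = ∫ x, f x ∂μ) {l : ℝ} (h0 : 0 < l) (h1 : l < 1)
    (h : IsUPI (resolventOp l S)) : OscWPI S := by
  intro r hr
  obtain ⟨δ, hδ, hUPI⟩ := h (r / 4) (by linarith)
  set R := resolventOp l S with hR
  set k : ℝ := (1 - l) * (r / 4 * δ) with hk
  have hk0 : 0 < k := mul_pos (by linarith) (by positivity)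
  refine ⟨2 * ‖R‖ ^ 2 / k ^ 2, by positivity, fun f hf c M hc => ?_⟩
  have hD := dirichlet_nonneg hS f
  have hM : 0 ≤ M := by
    obtain ⟨x, hx⟩ := hc.exists
    linarith
  -- Here the oscillation term alone suffices; otherwise the energy will control `M ^ 2 ≥ ‖f‖ ^ 2`.
  by_cases hn : ‖f‖ ^ 2 ≤ r * M ^ 2
  · have : 0 ≤ 2 * ‖R‖ ^ 2 / k ^ 2 * dirichlet S f := by positivity
    linarith
  have hnM := norm_sq_le_of_integral_eq_zero hf hc
  have hM' : 0 < M := by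
    refine hM.lt_of_ne fun h => hn ?_
    subst h
    simpa using hnM
  have hm : Measurable f := (Lp.stronglyMeasurable f).measurable
  have hA : MeasurableSet {x | f x ≤ 0} := measurableSet_le hm measurable_const
  have hB : MeasurableSet {x | r * M / 4 ≤ f x} := measurableSet_le measurable_const hm
  have h2 := hUPI _ _ hA hB (le_measureReal_of_norm_sq hf hr hM'
    (abs_le_of_integral_eq_zero (integrable_coeFn f) hf hc) (not_le.1 hn).le hA hB
    (fun _ => Iff.rfl) (fun _ => Iff.rfl))
  have h3 := mul_inner_ind_le (P := (1 - l) • R) (fun u hu => ?_) (fun u => ?_) f (r * M / 4)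
    hA hB (fun _ => Iff.rfl) (fun _ hx => hx)
  · rw [_root_.smul_apply, _root_.smul_apply, inner_smul_right, sub_smul_resolventOp hS h0 h1,
      norm_smul, Real.norm_of_nonneg h0.le] at h3
    have h4 : k * M ≤ ‖R‖ * ‖f - S f‖ := by
      calc k * M = r * M / 4 * ((1 - l) * δ) := by rw [hk]; ring
        _ ≤ r * M / 4 * ((1 - l) * inner ℝ (ind (μ := μ) hA) (R (ind hB))) := by
            have : 0 ≤ 1 - l := by linarith
            gcongr
        _ ≤ l * ‖R (f - S f)‖ := h3
        _ ≤ 1 * ‖R (f - S f)‖ := by gcongr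
        _ ≤ ‖R‖ * ‖f - S f‖ := by
            rw [one_mul]
            exact R.le_opNorm _
    have h5 : (k * M) ^ 2 ≤ (‖R‖ * ‖f - S f‖) ^ 2 := by gcongr
    have h6 : k ^ 2 * M ^ 2 ≤ ‖R‖ ^ 2 * (2 * dirichlet S f) := by
      rw [mul_pow k, mul_pow ‖R‖] at h5
      exact h5.trans (by gcongr; exact norm_sub_apply_sq_le hS f)
    have h7 : M ^ 2 ≤ 2 * ‖R‖ ^ 2 / k ^ 2 * dirichlet S f := by
      rw [div_mul_eq_mul_div, le_div_iff₀ (by positivity)]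
      linarith
    nlinarith [sq_nonneg M]
  · have := resolventOp_nonneg hS h0 h1 hpos hu
    rw [_root_.smul_apply, ← Lp.coeFn_nonneg]
    filter_upwards [(Lp.coeFn_nonneg _).2 this, Lp.coeFn_smul (1 - l) (R u)] with x hx hx'
    rw [hx', Pi.smul_apply, smul_eq_mul]
    exact mul_nonneg (by linarith) hx
  · rw [_root_.smul_apply, ← integral_resolventOp hS h0 h1 hint u, ← integral_const_mul]
    exact integral_congr_ae (Lp.coeFn_smul (1 - l) (R u))

end WeakPoincare

/-! ### From the weak Poincaré inequality to UPI of every resolvent. -/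

namespace WeakPoincare

/-- For `u ≥ -2`, squaring `exp (u / 2) ≥ 1 + u / 2` gives the constant `4`; for `u < -2`, `exp u -
1 - u ≥ |u| / 2` and `|u| ≤ M` give `2 * M`. Linear growth in `M` is what the final comparison
needs. -/
theorem sq_le_mul_exp_sub {M u : ℝ} (hM : 0 ≤ M) (hu : -M ≤ u) :
    u ^ 2 ≤ (4 + 2 * M) * (Real.exp u - 1 - u) := by
  have h0 : 0 ≤ Real.exp u - 1 - u := by linarith [Real.add_one_le_exp u]
  rcases le_or_gt (-2) u with h | h
  · have h1 : 1 + u / 2 ≤ Real.exp (u / 2) := by linarith [Real.add_one_le_exp (u / 2)]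
    have h2 : (1 + u / 2) ^ 2 ≤ Real.exp u := by
      calc (1 + u / 2) ^ 2 ≤ Real.exp (u / 2) ^ 2 := pow_le_pow_left₀ (by linarith) h1 2
        _ = Real.exp u := by rw [← Real.exp_nat_mul]; ring_nf
    nlinarith [mul_nonneg hM h0]
  · have h1 : -u / 2 ≤ Real.exp u - 1 - u := by linarith [Real.exp_pos u]
    nlinarith

variable {E : Type*} [MeasurableSpace E] {μ : Measure E} [IsProbabilityMeasure μ]
  {T : Kernel E E} [IsMarkovKernel T]

theorem integrable_of_abs_le {ν : Measure E} [IsFiniteMeasure ν] {f : E → ℝ} (hf : Measurable f)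
    {K : ℝ} (hK : ∀ x, |f x| ≤ K) : Integrable f ν :=
  Integrable.of_bound hf.aestronglyMeasurable K (Eventually.of_forall hK)

theorem abs_integral_le {ν : Measure E} [IsProbabilityMeasure ν] {f : E → ℝ} {K : ℝ}
    (hK : ∀ x, |f x| ≤ K) : |∫ y, f y ∂ν| ≤ K := by
  simpa using norm_integral_le_of_norm_le_const (μ := ν) (f := f) (Eventually.of_forall hK)

/-- `2 𝓔(T, f) = ∫∫ (f(y) - f(x))² T(x, dy) μ(dx)` for bounded `f`. -/
theorem two_mul_dirichlet_markovOp (hT : T.Invariant μ) {F : Lp ℝ 2 μ} {f : E → ℝ}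
    (hF : F =ᵐ[μ] f) (hf : Measurable f) {K : ℝ} (hK : ∀ x, |f x| ≤ K) :
    Integrable (fun x => ∫ y, (f y - f x) ^ 2 ∂(T x)) μ ∧
      2 * dirichlet (markovOp T μ hT) F = ∫ x, ∫ y, (f y - f x) ^ 2 ∂(T x) ∂μ := by
  have hK2 : ∀ x, |f x ^ 2| ≤ K ^ 2 := fun x => by
    rw [abs_pow]
    exact pow_le_pow_left₀ (abs_nonneg _) (hK x) 2
  have hf2 : Measurable fun x => f x ^ 2 := hf.pow_const 2
  have hTf : Measurable fun x => ∫ y, f y ∂(T x) :=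
    (StronglyMeasurable.integral_kernel hf.stronglyMeasurable).measurable
  have hTf2 : Measurable fun x => ∫ y, f y ^ 2 ∂(T x) :=
    (StronglyMeasurable.integral_kernel hf2.stronglyMeasurable).measurable
  have hexp : ∀ x, ∫ y, (f y - f x) ^ 2 ∂(T x)
      = ∫ y, f y ^ 2 ∂(T x) - 2 * (f x * ∫ y, f y ∂(T x)) + f x ^ 2 := fun x => by
    have h1 : Integrable (fun y => f y ^ 2) (T x) := integrable_of_abs_le hf2 hK2
    have h2 : Integrable f (T x) := integrable_of_abs_le hf hK
    have h3 : ∀ y, (f y - f x) ^ 2 = f y ^ 2 - (2 * f x) * f y + f x ^ 2 := fun y => by ring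
    have h4 : Integrable (fun y => f y ^ 2 - (2 * f x) * f y) (T x) := h1.sub (h2.const_mul _)
    simp_rw [h3]
    rw [integral_add h4 (integrable_const _),
      integral_sub h1 (h2.const_mul _), integral_const_mul]
    simp only [integral_const, probReal_univ, one_smul]
    ring
  have i1 : Integrable (fun x => ∫ y, f y ^ 2 ∂(T x)) μ := integrable_of_abs_le hTf2 (fun _ => abs_integral_le hK2)
  have i2 : Integrable (fun x => f x * ∫ y, f y ∂(T x)) μ :=
    integrable_of_abs_le (hf.mul hTf) (K := K * K) fun x => by
      rw [abs_mul]
      exact mul_le_mul (hK x) (abs_integral_le hK) (abs_nonneg _) ((abs_nonneg _).trans (hK x))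
  have i3 : Integrable (fun x => f x ^ 2) μ := integrable_of_abs_le hf2 hK2
  have i4 : Integrable (fun x => ∫ y, f y ^ 2 ∂(T x) - 2 * (f x * ∫ y, f y ∂(T x))) μ :=
    i1.sub (i2.const_mul 2)
  simp_rw [hexp]
  refine ⟨i4.add i3, ?_⟩
  rw [integral_add i4 i3, integral_sub i1 (i2.const_mul 2),
    integral_const_mul, integral_integral_of_invariant hT i3]
  have h4 : dirichlet (markovOp T μ hT) F = ∫ x, f x ^ 2 ∂μ - ∫ x, f x * ∫ y, f y ∂(T x) ∂μ := by
    have h5 : dirichlet (markovOp T μ hT) F = ‖F‖ ^ 2 - inner ℝ (markovOp T μ hT F) F := by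
      simp [dirichlet, inner_sub_left]
    rw [h5, norm_sq_eq_integral, L2.inner_def]
    congr 1
    · exact integral_congr_ae (hF.mono fun x hx => by simp only [hx])
    · refine integral_congr_ae ?_
      filter_upwards [hF, coeFn_markovOp hT F, ae_ae_of_invariant hT hF] with x h6 h7 h8
      simp [h6, h7, integral_congr_ae h8]
  rw [h4]
  ring

/-- The Dirichlet form of the logarithm of an `l`-excessive function grows at most linearly in the
oscillation. -/
theorem dirichlet_log_le (hT : T.Invariant μ) {h : E → ℝ} (hh : Measurable h) {a b : ℝ}
    (ha : 0 < a) (hab : ∀ x, a ≤ h x ∧ h x ≤ b) {M : ℝ} (hM : Real.log b - Real.log a ≤ M)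
    {l : ℝ} (h0 : 0 < l) (hl : ∀ᵐ x ∂μ, l * ∫ y, h y ∂(T x) ≤ h x) {F : Lp ℝ 2 μ} {m : ℝ}
    (hF : F =ᵐ[μ] fun x => Real.log (h x) - m) :
    dirichlet (markovOp T μ hT) F ≤ (2 + M) * (1 / l - 1) := by
  set f : E → ℝ := fun x => Real.log (h x) - m with hf
  have hpos : ∀ x, 0 < h x := fun x => ha.trans_le (hab x).1
  have hfm : Measurable f := hh.log.sub_const m
  have hlog : ∀ x, Real.log a ≤ Real.log (h x) ∧ Real.log (h x) ≤ Real.log b := fun x =>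
    ⟨Real.log_le_log ha (hab x).1, Real.log_le_log (hpos x) (hab x).2⟩
  obtain ⟨K, hK⟩ : ∃ K, ∀ x, |f x| ≤ K :=
    ⟨max |Real.log a - m| |Real.log b - m|, fun x =>
      abs_le_max_abs_abs (by simp only [hf]; linarith [(hlog x).1])
        (by simp only [hf]; linarith [(hlog x).2])⟩
  have hM0 : 0 ≤ M := by
    obtain ⟨x⟩ := nonempty_of_isProbabilityMeasure μ
    linarith [(hlog x).1, (hlog x).2]
  obtain ⟨hI, hD⟩ := two_mul_dirichlet_markovOp hT hF hfm hK
  have hTf : Measurable fun x => ∫ y, f y ∂(T x) :=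
    (StronglyMeasurable.integral_kernel hfm.stronglyMeasurable).measurable
  have ifm : Integrable f μ := integrable_of_abs_le hfm hK
  have iTf : Integrable (fun x => ∫ y, f y ∂(T x)) μ := 
    integrable_of_abs_le hTf fun _ => abs_integral_le hK
  have key : ∀ᵐ x ∂μ, ∫ y, (f y - f x) ^ 2 ∂(T x)
      ≤ (4 + 2 * M) * ((1 / l - 1) - (∫ y, f y ∂(T x) - f x)) := by
    filter_upwards [hl] with x hx
    have ih : Integrable h (T x) := integrable_of_abs_le hh (K := b) fun y => by
      rw [abs_of_pos (hpos y)]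
      exact (hab y).2
    have ift : Integrable f (T x) := integrable_of_abs_le hfm hK
    -- With `u = f y - f x`, `exp u = h y / h x`, whose `T x`-average is at most `1 / l` by
    -- excessivity. The remaining `T f - f` integrates to zero by invariance.
    have hpt : ∀ y, (f y - f x) ^ 2 ≤ (4 + 2 * M) * (h y / h x - 1 - (f y - f x)) := fun y => by
      have hd : f y - f x = Real.log (h y) - Real.log (h x) := by simp only [hf]; ring
      have h1 := sq_le_mul_exp_sub (M := M) (u := f y - f x) hM0
        (by linarith [(hlog x).2, (hlog y).1])
      have h2 : Real.exp (f y - f x) = h y / h x := by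
        rw [hd, Real.exp_sub, Real.exp_log (hpos y), Real.exp_log (hpos x)]
      rwa [h2] at h1
    have i1 : Integrable (fun y => h y / h x - 1) (T x) :=
      (ih.div_const _).sub (integrable_const 1)
    have i2 : Integrable (fun y => f y - f x) (T x) := ift.sub (integrable_const _)
    have h1 := integral_mono_of_nonneg (Eventually.of_forall fun y => sq_nonneg (f y - f x))
      ((i1.sub i2).const_mul (4 + 2 * M)) (Eventually.of_forall hpt)
    refine h1.trans ?_
    rw [integral_const_mul, integral_sub' i1 i2, integral_sub (ih.div_const _) (integrable_const 1),
      integral_sub ift (integrable_const _), integral_div]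
    simp only [integral_const, probReal_univ, one_smul]
    have h2 : (∫ y, h y ∂(T x)) / h x ≤ 1 / l := by
      rw [div_le_div_iff₀ (hpos x) h0]
      linarith
    gcongr
  have i1 : Integrable (fun x => ∫ y, f y ∂(T x) - f x) μ := iTf.sub ifm
  have h1 := integral_mono_ae hI
    (((integrable_const (1 / l - 1)).sub i1).const_mul (4 + 2 * M)) key
  rw [← hD, integral_const_mul, integral_sub' (integrable_const _) i1, integral_sub iTf ifm,
    integral_integral_of_invariant hT ifm] at h1
  simp only [integral_const, probReal_univ, one_smul] at h1
  linarith

/-- Expand `0 ≤ ‖f - k 1_A‖²`. -/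
theorem sq_mul_measureReal_le_norm_sq {A : Set E} (hA : MeasurableSet A) (f : Lp ℝ 2 μ) {k : ℝ}
    (hk : 0 ≤ k) (h : k * μ.real A ≤ ∫ x in A, f x ∂μ) : k ^ 2 * μ.real A ≤ ‖f‖ ^ 2 := by
  have h1 : ‖ind (μ := μ) hA‖ ^ 2 = μ.real A := by
    rw [← real_inner_self_eq_norm_sq, inner_ind, setIntegral_congr_ae hA
      ((coeFn_ind hA).mono fun x hx _ => hx), integral_indicator hA]
    simp
  have h2 := sq_nonneg ‖f - k • ind (μ := μ) hA‖
  rw [norm_sub_sq_real, inner_smul_right, real_inner_comm, inner_ind, norm_smul, mul_pow, h1,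
    Real.norm_of_nonneg hk] at h2
  nlinarith

/-- Since `q - p = 2 k`, either `q ≥ k` or `p ≤ -k`, so one of the two sets alone forces the bound,
wherever `f` is centred. -/
theorem sq_mul_le_norm_sq_of_separated {A B : Set E} (hA : MeasurableSet A) (hB : MeasurableSet B)
    (f : Lp ℝ 2 μ) {ε p q : ℝ} (hεA : ε ≤ μ.real A) (hεB : ε ≤ μ.real B)
    (hp : ∫ x in A, f x ∂μ ≤ μ.real A * p) (hq : μ.real B * q ≤ ∫ x in B, f x ∂μ) (hpq : p ≤ q) :
    ((q - p) / 2) ^ 2 * ε ≤ ‖f‖ ^ 2 := by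
  set k : ℝ := (q - p) / 2 with hk
  have hk0 : 0 ≤ k := by linarith
  have hA0 : 0 ≤ μ.real A := measureReal_nonneg
  have hB0 : 0 ≤ μ.real B := measureReal_nonneg
  rcases le_total k q with h | h
  · have h1 : k * μ.real B ≤ ∫ x in B, f x ∂μ := by
      rw [mul_comm]
      exact (mul_le_mul_of_nonneg_left h hB0).trans hq
    exact (mul_le_mul_of_nonneg_left hεB (sq_nonneg k)).trans
      (sq_mul_measureReal_le_norm_sq hB f hk0 h1)
  · have h1 : k * μ.real A ≤ ∫ x in A, (-f) x ∂μ := by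
      have h2 : ∫ x in A, (-f) x ∂μ = -∫ x in A, f x ∂μ := by
        rw [← inner_ind hA, inner_neg_right, inner_ind]
      have h3 := mul_le_mul_of_nonneg_left (show k ≤ -p by linarith) hA0
      rw [h2]
      linarith
    have h2 := sq_mul_measureReal_le_norm_sq hA (-f) hk0 h1
    rw [norm_neg] at h2
    exact (mul_le_mul_of_nonneg_left hεA (sq_nonneg k)).trans h2

/-- The normalized resolvent of an indicator has an everywhere-defined version with values in
`[0, 1]`. -/
theorem exists_resolvent_ind (hT : T.Invariant μ) {l : ℝ} (h0 : 0 < l) (h1 : l < 1) {B : Set E}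
    (hB : MeasurableSet B) : ∃ g : E → ℝ, Measurable g ∧ (∀ x, 0 ≤ g x ∧ g x ≤ 1) ∧
      (∀ᵐ x ∂μ, l * ∫ y, g y ∂(T x) ≤ g x) ∧ (∀ᵐ x ∂μ, x ∈ B → 1 - l ≤ g x) ∧
      ∀ {A : Set E} (hA : MeasurableSet A), ∫ x in A, g x ∂μ
        = (1 - l) * inner ℝ (ind (μ := μ) hA) (resolventOp l (markovOp T μ hT) (ind hB)) := by
  set S := markovOp T μ hT with hS
  have hS1 : ‖S‖ ≤ 1 := norm_markovOp_le hT
  have hpos : ∀ f, 0 ≤ f → 0 ≤ S f := fun f hf => markovOp_nonneg hT hf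
  set R := resolventOp l S with hR
  set V := R (ind hB) with hV
  set one : Lp ℝ 2 μ := Lp.const 2 μ (1 : ℝ) with hone
  have hind0 : 0 ≤ ind (μ := μ) hB := by
    rw [← Lp.coeFn_nonneg]
    filter_upwards [coeFn_ind (μ := μ) hB] with x hx
    rw [hx]
    exact indicator_nonneg (fun _ _ => zero_le_one) x
  have hind1 : 0 ≤ one - ind (μ := μ) hB := by
    rw [sub_nonneg, ← Lp.coeFn_le]
    filter_upwards [coeFn_ind (μ := μ) hB, Lp.coeFn_const (p := 2) (μ := μ) (1 : ℝ)] with x hx hx'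
    rw [hx, hx']
    exact indicator_le_self' (fun _ _ => zero_le_one) x
  have hV0 : 0 ≤ V := resolventOp_nonneg hS1 h0 h1 hpos hind0
  have hSV0 : 0 ≤ S V := hpos V hV0
  have hV1 : 0 ≤ R one - V := by
    have := resolventOp_nonneg hS1 h0 h1 hpos hind1
    rwa [map_sub] at this
  have hRone := resolventOp_apply_sub hS1 h0 h1 one
  rw [← hR, hone, hS, markovOp_const hT, ← hone] at hRone
  have hres := sub_apply_resolventOp hS1 h0 h1 (ind hB)
  rw [← hR, ← hV] at hres
  have hRone' : ∀ᵐ x ∂μ, (1 - l) * R one x = 1 := by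
    have h2 : (1 - l) • R one = one := by
      nth_rw 2 [← hRone]
      module
    filter_upwards [Lp.coeFn_smul (1 - l) (R one), Lp.coeFn_const (p := 2) (μ := μ) (1 : ℝ)]
      with x hx hx'
    rw [h2, hx'] at hx
    exact hx.symm
  have hres' : ∀ᵐ x ∂μ, V x - l * S V x = B.indicator (fun _ => 1) x := by
    filter_upwards [Lp.coeFn_sub V (l • S V), Lp.coeFn_smul l (S V), coeFn_ind (μ := μ) hB]
      with x hx hx' hx''
    rw [hres, hx'', Pi.sub_apply, hx'] at hx
    exact hx.symm
  have hV0' := (Lp.coeFn_nonneg _).2 hV0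
  have hSV0' := (Lp.coeFn_nonneg _).2 hSV0
  have hV1' : ∀ᵐ x ∂μ, V x ≤ R one x := by
    filter_upwards [(Lp.coeFn_nonneg _).2 hV1, Lp.coeFn_sub (R one) V] with x hx hx'
    rw [hx'] at hx
    exact sub_nonneg.1 hx
  have hVm : Measurable V := (Lp.stronglyMeasurable V).measurable
  -- Clamping changes only a null set and makes the bounds hold everywhere, so logarithms can be
  -- handled pointwise.
  set g : E → ℝ := fun x => max 0 (min 1 ((1 - l) * V x)) with hg
  have hl : 0 < 1 - l := by linarith
  have hgV : ∀ᵐ x ∂μ, g x = (1 - l) * V x := by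
    filter_upwards [hV0', hV1', hRone'] with x hx hx' hx''
    have h2 : (1 - l) * V x ≤ 1 := (mul_le_mul_of_nonneg_left hx' hl.le).trans_eq hx''
    simp only [hg]
    rw [min_eq_right h2, max_eq_right (mul_nonneg hl.le hx)]
  refine ⟨g, by fun_prop, fun x => ⟨le_max_left _ _, max_le zero_le_one (min_le_left _ _)⟩,
    ?_, ?_, fun hA => ?_⟩
  · filter_upwards [hgV, ae_ae_of_invariant hT hgV, coeFn_markovOp hT V, hres'] with x h2 h3 h4 h5
    rw [h2, integral_congr_ae h3, integral_const_mul, ← h4]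
    have h6 : 0 ≤ B.indicator (fun _ => (1 : ℝ)) x := indicator_nonneg (fun _ _ => zero_le_one) x
    nlinarith
  · filter_upwards [hgV, hres', hSV0'] with x h2 h3 h4 hxB
    rw [indicator_of_mem hxB] at h3
    have h5 : 0 ≤ l * S V x := mul_nonneg h0.le h4
    rw [h2]
    nlinarith
  · rw [inner_ind, setIntegral_congr_ae hA (hgV.mono fun x hx _ => hx), integral_const_mul]

/-- `M ≥ 4 (K + 1)` makes the right side at least `ε (3 M / 8)²`, which exceeds `ε M² / 16` by `5 ε
M² / 64`; `M ≥ 10 (Q + 1)` lets this surplus absorb the linear term. -/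
theorem growth_lt {ε C t K Q M : ℝ} (hε : 0 < ε) (hC : 0 ≤ C) (ht : 0 ≤ t) (hK : 0 ≤ K)
    (hQ : Q = C * t * (4 / ε)) (hM : M = 4 * (K + 1) + 10 * (Q + 1)) :
    C * ((2 + M) * t) + ε / 16 * M ^ 2 < ((M - 1 - K) / 2) ^ 2 * ε := by
  have hQ0 : 0 ≤ Q := by rw [hQ]; positivity
  have h1 : C * ((2 + M) * t) = ε * (Q * (2 + M) / 4) := by
    rw [hQ]
    field_simp
  have h2 : (3 / 8 * M) ^ 2 ≤ ((M - 1 - K) / 2) ^ 2 :=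
    pow_le_pow_left₀ (by linarith) (by linarith) 2
  have h3 : 10 * (Q + 1) * M ≤ M * M :=
    mul_le_mul_of_nonneg_right (by linarith) (by linarith)
  have h4 : 0 ≤ Q * M := mul_nonneg hQ0 (by linarith)
  have h5 : Q * (2 + M) / 4 + M ^ 2 / 16 < ((M - 1 - K) / 2) ^ 2 := by
    have h6 : Q ≤ M := by linarith
    linarith
  have h7 := mul_lt_mul_of_pos_left h5 hε
  rw [h1]
  linarith

theorem OscWPI.isUPI_resolventOp (hT : T.Invariant μ) (h : OscWPI (markovOp T μ hT)) {l : ℝ}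
    (h0 : 0 < l) (h1 : l < 1) : IsUPI (resolventOp l (markovOp T μ hT)) := by
  intro ε hε
  obtain ⟨C, hC, hW⟩ := h (ε / 16) (by linarith)
  have hl : 0 < 1 - l := by linarith
  have hl' : 0 ≤ 1 / l - 1 := by
    rw [sub_nonneg, le_div_iff₀ h0]
    linarith
  set K : ℝ := 1 / ε - Real.log (1 - l) with hK
  have hK0 : 0 ≤ K := by
    have := Real.log_nonpos hl.le (by linarith)
    have : 0 ≤ 1 / ε := by positivity
    linarith
  set Q : ℝ := C * (1 / l - 1) * (4 / ε) with hQ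
  have hQ0 : 0 ≤ Q := by positivity
  set M : ℝ := 4 * (K + 1) + 10 * (Q + 1) with hM
  -- `a` is both the UPI bound to be refuted and the shift inside the logarithm. As `a ≤ g + a ≤ 2`
  -- and `log 2 ≤ 1`, the oscillation is at most `M`.
  set a : ℝ := Real.exp (1 - M) with ha
  have ha0 : 0 < a := Real.exp_pos _
  have hloga : Real.log a = 1 - M := Real.log_exp _
  have ha1 : a ≤ 1 := Real.exp_le_one_iff.2 (by linarith)
  clear_value a
  refine ⟨a, ha0, fun A B hA hB hAB => ?_⟩
  by_contra! hlt
  obtain ⟨hεA, hεB⟩ := le_min_iff.1 hAB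
  obtain ⟨g, hgm, hg01, hgT, hgB, hgA⟩ := exists_resolvent_ind (μ := μ) hT h0 h1 hB
  have hgi : Integrable g μ := integrable_of_abs_le hgm (K := 1) fun x => by
    rw [abs_of_nonneg (hg01 x).1]
    exact (hg01 x).2
  have hAa : ∫ x in A, g x ∂μ ≤ a := by
    have h2 : 0 ≤ ∫ x in A, g x ∂μ := integral_nonneg fun x => (hg01 x).1
    rw [hgA hA] at h2 ⊢
    have h3 := nonneg_of_mul_nonneg_right h2 hl
    nlinarith
  have hbd : ∀ x, a ≤ g x + a ∧ g x + a ≤ 2 := fun x =>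
    ⟨by linarith [(hg01 x).1], by linarith [(hg01 x).2]⟩
  have hlog : ∀ x, 1 - M ≤ Real.log (g x + a) ∧ Real.log (g x + a) ≤ 1 := fun x => by
    have h3 := Real.log_le_log (ha0.trans_le (hbd x).1) (hbd x).2
    exact ⟨hloga ▸ Real.log_le_log ha0 (hbd x).1, by linarith [Real.log_two_lt_d9]⟩
  have hlogm : Measurable fun x => Real.log (g x + a) := (hgm.add_const a).log
  have hlogb : ∀ x, |Real.log (g x + a)| ≤ M := fun x =>
    abs_le.2 ⟨by linarith [(hlog x).1], by linarith [(hlog x).2]⟩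
  have hlogi : Integrable (fun x => Real.log (g x + a)) μ := integrable_of_abs_le hlogm hlogb
  set m : ℝ := ∫ x, Real.log (g x + a) ∂μ with hm
  have hmem : MemLp (fun x => Real.log (g x + a) - m) 2 μ :=
    (MemLp.of_bound hlogm.aestronglyMeasurable M (Eventually.of_forall hlogb)).sub (memLp_const m)
  set F : Lp ℝ 2 μ := hmem.toLp _
  have hF : F =ᵐ[μ] fun x => Real.log (g x + a) - m := hmem.coeFn_toLp
  clear_value F
  have hF0 : ∫ x, F x ∂μ = 0 := by
    rw [integral_congr_ae hF, integral_sub hlogi (integrable_const m)]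
    simp [hm]
  have hE := dirichlet_log_le hT (hgm.add_const a) ha0 hbd (M := M)
    (by linarith [Real.log_two_lt_d9]) h0 (by
      filter_upwards [hgT] with x hx
      have hgt : Integrable g (T x) := integrable_of_abs_le hgm (K := 1) fun x => by
        rw [abs_of_nonneg (hg01 x).1]
        exact (hg01 x).2
      rw [integral_add hgt (integrable_const a)]
      simp only [integral_const, probReal_univ, one_smul]
      nlinarith) hF
  have hN := hW F hF0 (1 - M - m) M (hF.mono fun x hx => by
    rw [hx]
    exact ⟨by linarith [(hlog x).1], by linarith [(hlog x).2]⟩)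
  have hFi : ∀ D : Set E, ∫ x in D, F x ∂μ = ∫ x in D, Real.log (g x + a) ∂μ - μ.real D * m := by
    intro D
    rw [integral_congr_ae (ae_restrict_of_ae hF), integral_sub hlogi.integrableOn
      (integrable_const m).integrableOn]
    simp
  have hIB : μ.real B * (Real.log (1 - l) - m) ≤ ∫ x in B, F x ∂μ := by
    have h2 : ∫ _ in B, Real.log (1 - l) ∂μ ≤ ∫ x in B, Real.log (g x + a) ∂μ := by
      refine setIntegral_mono_on_ae (integrable_const _).integrableOn hlogi.integrableOn hB ?_
      filter_upwards [hgB] with x hx hxB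
      exact Real.log_le_log hl (by linarith [hx hxB])
    rw [setIntegral_const, smul_eq_mul] at h2
    rw [hFi]
    linarith
  have hIA : ∫ x in A, F x ∂μ ≤ μ.real A * (1 - M + 1 / ε - m) := by
    -- From `log (1 + g / a) ≤ g / a`. The integral of `g / a` over `A` is at most `1 ≤ μ(A) / ε`,
    -- the source of `1 / ε` in `K`.
    have h2 : ∫ x in A, Real.log (g x + a) ∂μ ≤ ∫ x in A, (g x / a + (1 - M)) ∂μ := by
      refine setIntegral_mono hlogi.integrableOn
        ((hgi.div_const a).add (integrable_const _)).integrableOn fun x => ?_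
      have h3 := Real.log_le_sub_one_of_pos (div_pos (ha0.trans_le (hbd x).1) ha0)
      rw [Real.log_div (ha0.trans_le (hbd x).1).ne' ha0.ne', hloga, add_div,
        div_self ha0.ne'] at h3
      dsimp only
      linarith
    rw [integral_add (hgi.div_const a).integrableOn (integrable_const _).integrableOn,
      integral_div, setIntegral_const, smul_eq_mul] at h2
    have h3 : (∫ x in A, g x ∂μ) / a ≤ 1 := (div_le_one ha0).2 hAa
    have h4 : 1 ≤ μ.real A * (1 / ε) := by
      rw [mul_one_div]
      exact (one_le_div hε).2 hεA
    rw [hFi]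
    linarith
  have hkN := sq_mul_le_norm_sq_of_separated hA hB F hεA hεB hIA hIB (by linarith)
  have hD : Real.log (1 - l) - m - (1 - M + 1 / ε - m) = M - 1 - K := by
    rw [hK]
    ring
  rw [hD] at hkN
  refine absurd (hkN.trans (hN.trans (add_le_add_left (mul_le_mul_of_nonneg_left hE hC) _)))
    (not_le.2 ?_)
  exact growth_lt hε hC hl' hK0 hQ hM

end WeakPoincare

theorem mainTheorem2 {E : Type*} [MeasurableSpace E] (μ : Measure E) [IsProbabilityMeasure μ]
    (T : Kernel E E) [IsMarkovKernel T] (hT : T.Invariant μ) :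
    ((∃ α : ℝ → ℝ, WeakPoincare.AlphaWPI WeakPoincare.oscSq α (WeakPoincare.markovOp T μ hT)) ↔
      WeakPoincare.IsRUPI (WeakPoincare.markovOp T μ hT)) ∧
    ((∃ β : ℝ → ℝ, WeakPoincare.BetaWPI WeakPoincare.oscSq β (WeakPoincare.markovOp T μ hT)) ↔
      WeakPoincare.IsRUPI (WeakPoincare.markovOp T μ hT)) ∧
    (WeakPoincare.IsRUPI (WeakPoincare.markovOp T μ hT) ↔
      ∀ l : ℝ, 0 < l → l < 1 →
        WeakPoincare.IsUPI (WeakPoincare.resolventOp l (WeakPoincare.markovOp T μ hT))) := by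
  have hS := WeakPoincare.norm_markovOp_le (μ := μ) hT
  have hall : (∀ l : ℝ, 0 < l → l < 1 →
      WeakPoincare.IsUPI (WeakPoincare.resolventOp l (WeakPoincare.markovOp T μ hT))) →
      WeakPoincare.IsRUPI (WeakPoincare.markovOp T μ hT) := fun h =>
    ⟨1 / 2, by norm_num, by norm_num, h (1 / 2) (by norm_num) (by norm_num)⟩
  have hUPI : WeakPoincare.OscWPI (WeakPoincare.markovOp T μ hT) → ∀ l : ℝ, 0 < l → l < 1 →
      WeakPoincare.IsUPI (WeakPoincare.resolventOp l (WeakPoincare.markovOp T μ hT)) :=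
    fun h _ h0 h1 => h.isUPI_resolventOp hT h0 h1
  have hWPI : WeakPoincare.IsRUPI (WeakPoincare.markovOp T μ hT) →
      WeakPoincare.OscWPI (WeakPoincare.markovOp T μ hT) := fun ⟨_, h0, h1, h⟩ =>
    .of_isUPI_resolventOp hS (fun _ hf => WeakPoincare.markovOp_nonneg hT hf)
      (WeakPoincare.integral_markovOp hT) h0 h1 h
  refine ⟨⟨fun ⟨_, h⟩ => hall (hUPI (.of_alphaWPI h)), fun h => (hWPI h).exists_alphaWPI hS⟩,
    ⟨fun ⟨_, h⟩ => hall (hUPI (.of_betaWPI h)), fun h => (hWPI h).exists_betaWPI hS⟩,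
    fun h => hUPI (hWPI h), hall⟩
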